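/- All graphs are finite and simple. A graph $G$ is *hypohamiltonian* if $G$ is not hamiltonian but $G-u$ has a hamiltonian cycle for every vertex $u$ of $G$. The *circumference* $\mathrm{circ}(G)$ is the length of a longest cycle of $G$. A graph is *PMH* if each of its perfect matchings is contained in (the edge set of) a hamiltonian cycle of the graph. The *line graph* $L(G)$ has the edges of $G$ as its vertices, two of them being adjacent if they are distinct and share an end-vertex in $G$. A *$Y$-extension* of a vertex $u$ in a cubic graph replaces $u$ by a triangle: the three edges formerly incident with $u$ become incident with the three vertices of the triangle, one edge at each. **Proposition.** Let $G$ be a hypohamiltonian cubic graph whose number of edges $|E(G)|$ is odd. Let $v$ be any vertex of $G$, and let $G'$ be the graph obtained from $G$ by performing a $Y$-extension at every vertex of $G$ except $v$. Then $\mathrm{circ}(G') = |V(G')|-1$, and the line graph $L(G')$ is not PMH. -/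

import Mathlib

namespace PMHLine

/-- `G` is hypohamiltonian: it is not hamiltonian, but every vertex-deleted subgraph `G - v`
has a hamiltonian cycle (in particular `G - v` has at least three vertices). -/
def IsHypohamiltonian {V : Type*} [Fintype V] [DecidableEq V] (G : SimpleGraph V) : Prop :=
  ¬ G.IsHamiltonian ∧
    ∀ v : V, ∃ (a : ({v}ᶜ : Set V)) (p : (G.induce ({v}ᶜ : Set V)).Walk a a),
      p.IsHamiltonianCycle

/-- The circumference of a finite graph: the length of a longest cycle
(and `0` for a graph without cycles). -/
noncomputable def circumference {V : Type*} (G : SimpleGraph V) : ℕ :=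
  sSup {k : ℕ | ∃ (a : V) (p : G.Walk a a), p.IsCycle ∧ p.length = k}

/-- The Perfect-Matching-Hamiltonian property: every perfect matching extends to
a hamiltonian cycle. -/
def IsPMH {V : Type*} [DecidableEq V] (G : SimpleGraph V) : Prop :=
  ∀ M : G.Subgraph, M.IsPerfectMatching →
    ∃ (a : V) (p : G.Walk a a), p.IsHamiltonianCycle ∧ ∀ e ∈ M.edgeSet, e ∈ p.edges

/-- The vertices of the graph obtained from `G` by expanding all vertices in `S`:
the vertices outside `S` are kept, and a vertex `s` in `S` is replaced by one new vertex for
each edge at `s`, represented by the dart `(s, t)` leaving `s`. If `s` has degree three, these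
are three new vertices. -/
abbrev YVertex {V : Type*} (G : SimpleGraph V) (S : Set V) : Type _ :=
  {w : V // w ∉ S} ⊕ {d : G.Dart // d.fst ∈ S}

/-- Adjacency after the expansion of the vertices in `S`: the new vertices that replace the
same vertex of `S` are pairwise adjacent (a triangle, if that vertex has degree three), and each
edge of `G` survives, with an end in `S` moved to the new vertex belonging to that edge. -/
def YAdj {V : Type*} (G : SimpleGraph V) (S : Set V) : YVertex G S → YVertex G S → Prop
  | .inl u, .inl w => G.Adj u.1 w.1
  | .inl u, .inr d => d.1.snd = u.1
  | .inr d, .inl u => d.1.snd = u.1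
  | .inr d, .inr e => (d ≠ e ∧ d.1.fst = e.1.fst) ∨ e.1 = d.1.symm

/-- The graph obtained from a cubic graph `G` by performing a Y-extension (expansion of a vertex
to a triangle) at every vertex of `S`. -/
def yExtension {V : Type*} (G : SimpleGraph V) (S : Set V) : SimpleGraph (YVertex G S) where
  Adj := YAdj G S
  symm := ⟨by
    rintro (u | d) (w | e) h
    · exact SimpleGraph.Adj.symm h
    · exact h
    · exact h
    · rcases h with ⟨h1, h2⟩ | h
      · exact Or.inl ⟨h1.symm, h2.symm⟩
      · exact Or.inr (by rw [h, SimpleGraph.Dart.symm_symm])⟩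
  loopless := ⟨by
    rintro (u | d) h
    · exact G.irrefl h
    · rcases h with ⟨h1, _⟩ | h
      · exact h1 rfl
      · exact d.1.symm_ne h.symm⟩

end PMHLine

namespace PMHLine

open SimpleGraph

/-! Both claims rest on one obstruction: no closed trail of G' meets every fibre of the contraction
G' → G. Distinct edges between fibres have distinct images, so such a trail would contract to a
closed trail through all vertices of G. In a cubic graph a closed trail has even degree at most
three, hence degree two, at each of its vertices, so it would trace a hamiltonian cycle of G
(`not_isHamiltonian_closed_trail`).

Circumference: the obstruction excludes a hamiltonian cycle of G'. Conversely, a hamiltonian cycle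
of G - v lifts to G', crossing each triangle through all three of its vertices, and misses only v.

Line graph: pairing edges at common ends amounts to assigning each edge to one of its ends. As
|E(G')| = 3(|E(G)| - 1) is even, parity corrections along the lifted cycle, which avoids v, produce
an assignment giving 0 or 2 edges to each vertex, with exactly two at v
(`exists_perfectMatching_lineGraph`). A hamiltonian cycle of L(G') containing this matching would
yield a closed trail of G' through the shared end of every matched pair. It would pass through v by
the pair there, and meet every triangle because a triangle edge can only be matched at a vertex of
its triangle. This contradicts the obstruction. -/

/-! ### Closed trails in graphs of maximum degree three, and contractions -/

theorem reachable_spanningCoe_toSubgraph {V : Type*} {G : SimpleGraph V} {a b : V}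
    (p : G.Walk a b) {x y : V} (hx : x ∈ p.support) (hy : y ∈ p.support) :
    p.toSubgraph.spanningCoe.Reachable x y :=
  (p.toSubgraph_connected.coe.preconnected ⟨x, p.mem_verts_toSubgraph.2 hx⟩
    ⟨y, p.mem_verts_toSubgraph.2 hy⟩).map
    (⟨Subtype.val, fun {_ _} h => h⟩ : p.toSubgraph.coe →g p.toSubgraph.spanningCoe)

/-- A closed trail through all vertices of a graph of maximum degree at most three forces a
hamiltonian cycle. -/
theorem isHamiltonian_of_closed_trail {V : Type*} [Fintype V] [DecidableEq V] [Nontrivial V]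
    (G : SimpleGraph V) [DecidableRel G.Adj] (hdeg : ∀ u, G.degree u ≤ 3)
    {a : V} (p : G.Walk a a) (hp : p.IsTrail) (hall : ∀ u, u ∈ p.support) :
    G.IsHamiltonian := by
  classical
  set F : SimpleGraph V := p.toSubgraph.spanningCoe with hF
  have hFadj : ∀ x y, F.Adj x y ↔ s(x, y) ∈ p.edges := by
    intro x y
    simp [hF, Walk.adj_toSubgraph_iff_mem_edges]
  have hFG : F ≤ G := p.toSubgraph.spanningCoe_le
  have hreach : ∀ x y, F.Reachable x y :=
    fun x y => reachable_spanningCoe_toSubgraph p (hall x) (hall y)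
  have hne : ∀ x, (F.neighborSet x).Nonempty := by
    intro x
    obtain ⟨y, hxy⟩ := exists_ne x
    obtain ⟨q⟩ := hreach x y
    cases q with
    | nil => exact absurd rfl hxy
    | cons h _ => exact ⟨_, h⟩
  have hcount : ∀ x, F.degree x = p.edges.countP fun e => x ∈ e := by
    intro x
    rw [← card_incidenceFinset_eq_degree, List.countP_eq_length_filter,
      ← List.toFinset_card_of_nodup (hp.edges_nodup.filter _)]
    congr 1
    ext e
    simp only [mem_incidenceFinset, incidenceSet, Set.mem_ofPred_eq, List.mem_toFinset,
      List.mem_filter, decide_eq_true_eq]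
    induction e with
    | _ c d => rw [mem_edgeSet, hFadj]
  -- A closed trail uses an even number of edges at each vertex, and 2 is the only positive even
  -- number up to 3. So `F` is 2-regular, and being connected it is a single cycle.
  have hcyc : F.IsCycles := by
    intro x hx
    have he : Even (F.degree x) := by
      rw [hcount, hp.even_countP_edges_iff]
      exact fun h => absurd rfl h
    have hpos : 0 < F.degree x := by
      obtain ⟨y, hy⟩ := hx
      exact (F.degree_pos_iff_exists_adj x).2 ⟨y, hy⟩
    have hle : F.degree x ≤ 3 := (degree_le_of_le hFG).trans (hdeg x)
    have h2 : F.degree x = 2 := by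
      obtain ⟨k, hk⟩ := he
      omega
    rw [Set.ncard_eq_toFinset_card', ← h2]
    rfl
  obtain ⟨q, hq, hverts⟩ := hcyc.exists_cycle_toSubgraph_verts_eq_connectedComponentSupp
    (c := F.connectedComponentMk a) (v := a) rfl (hne a)
  intro _
  refine ⟨a, q.mapLe hFG, ?_⟩
  have hqc : (q.mapLe hFG).IsCycle := hq.mapLe hFG
  refine ⟨hqc, hqc.isPath_tail.isHamiltonian_of_mem fun w => ?_⟩
  have hw : w ∈ q.support := by
    rw [← q.mem_verts_toSubgraph, hverts]
    exact ConnectedComponent.sound (hreach w a)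
  have hw' : w ∈ (q.mapLe hFG).support := by simpa using hw
  rw [Walk.support_tail_of_not_nil _ hqc.not_nil]
  rw [← Walk.cons_tail_support] at hw'
  rcases List.mem_cons.1 hw' with rfl | h
  · exact Walk.end_mem_tail_support hqc.not_nil
  · exact h

/-- The image of a walk under a map that sends each edge to an edge or to a single vertex. -/
theorem exists_walk_contract {W V : Type*} [DecidableEq V] {H : SimpleGraph W} {G : SimpleGraph V}
    {f : W → V} (hf : ∀ x y, H.Adj x y → f x = f y ∨ G.Adj (f x) (f y)) {a b : W}
    (p : H.Walk a b) :
    ∃ q : G.Walk (f a) (f b),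
      q.edges = (p.edges.map (Sym2.map f)).filter (fun e => ¬ e.IsDiag) ∧
      ∀ x ∈ p.support, f x ∈ q.support := by
  induction p with
  | nil => exact ⟨.nil, by simp, by simp⟩
  | @cons x y z h p ih =>
    obtain ⟨q, hq, hs⟩ := ih
    by_cases hxy : f x = f y
    · refine ⟨q.copy hxy.symm rfl, ?_, ?_⟩
      · simp [hq, hxy]
      · intro w hw
        rw [Walk.support_copy]
        rcases List.mem_cons.1 (Walk.support_cons h p ▸ hw) with rfl | hw
        · rw [hxy]; exact q.start_mem_support
        · exact hs w hw
    · refine ⟨.cons ((hf x y h).resolve_left hxy) q, ?_, ?_⟩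
      · simp [hq, hxy]
      · intro w hw
        rw [Walk.support_cons]
        rcases List.mem_cons.1 (Walk.support_cons h p ▸ hw) with rfl | hw
        · exact List.mem_cons_self
        · exact List.mem_cons_of_mem _ (hs w hw)

/-- If a graph contracts onto a graph of maximum degree at most three such that distinct surviving
edges stay distinct, then a closed trail meeting all fibres of the contraction yields a hamiltonian
cycle. -/
theorem isHamiltonian_of_contract_closed_trail {W V : Type*} [Fintype V] [DecidableEq V]
    [Nontrivial V] {H : SimpleGraph W} (G : SimpleGraph V) [DecidableRel G.Adj]
    (hdeg : ∀ u, G.degree u ≤ 3) {f : W → V}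
    (hf : ∀ x y, H.Adj x y → f x = f y ∨ G.Adj (f x) (f y))
    (hinj : ∀ e ∈ H.edgeSet, ∀ e' ∈ H.edgeSet, ¬ (Sym2.map f e).IsDiag →
      Sym2.map f e = Sym2.map f e' → e = e')
    {a : W} (p : H.Walk a a) (hp : p.IsTrail) (hall : ∀ u, ∃ x ∈ p.support, f x = u) :
    G.IsHamiltonian := by
  obtain ⟨q, hq, hs⟩ := exists_walk_contract hf p
  refine isHamiltonian_of_closed_trail G hdeg q ⟨?_⟩ ?_
  · rw [hq, List.filter_map]
    refine List.Nodup.map_on ?_ (hp.edges_nodup.filter _)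
    intro e he e' he' h
    rw [List.mem_filter] at he he'
    exact hinj e (p.edges_subset_edgeSet he.1) e' (p.edges_subset_edgeSet he'.1)
      (by simpa using he.2) h
  · intro u
    obtain ⟨x, hx, rfl⟩ := hall u
    exact hs x hx

/-! ### From cycles of the line graph to closed trails -/

/-- A walk in the line graph from `e` to `e'` can be followed in the graph itself, from a given end
of `e` to some end of `e'`. It passes through the common vertices of consecutive edges. -/
theorem exists_walk_of_lineGraph_walk {W : Type*} {H : SimpleGraph W} {e e' : H.edgeSet}
    (p : H.lineGraph.Walk e e') (x : W) (hx : x ∈ (e : Sym2 W)) :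
    ∃ (y : W) (_ : y ∈ (e' : Sym2 W)) (q : H.Walk x y),
      (q.edges).Sublist (p.support.dropLast.map Subtype.val) ∧
      ∀ c d : H.edgeSet, s(c, d) ∈ p.edges → ∃ z ∈ q.support, z ∈ (c : Sym2 W) ∧ z ∈ (d : Sym2 W) := by
  induction p generalizing x with
  | nil => exact ⟨x, hx, .nil, by simp, by simp⟩
  | @cons e g e' h p ih =>
    obtain ⟨w, hwe, hwg⟩ := (lineGraph_adj_iff_exists.1 h).2
    obtain ⟨y, hy, q, hq, hc⟩ := ih w hwg
    have hdl : (Walk.cons h p).support.dropLast = e :: p.support.dropLast := by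
      rw [Walk.support_cons, List.dropLast_cons_of_ne_nil p.support_ne_nil]
    have hc' : ∀ c d : H.edgeSet, s(c, d) ∈ (Walk.cons h p).edges →
        ∃ z ∈ q.support, z ∈ (c : Sym2 W) ∧ z ∈ (d : Sym2 W) := by
      intro c d hcd
      rw [Walk.edges_cons, List.mem_cons] at hcd
      rcases hcd with hcd | hcd
      · rcases Sym2.eq_iff.1 hcd with ⟨rfl, rfl⟩ | ⟨rfl, rfl⟩
        · exact ⟨w, q.start_mem_support, hwe, hwg⟩
        · exact ⟨w, q.start_mem_support, hwg, hwe⟩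
      · exact hc c d hcd
    -- The edge `e` is entered at `x` and left at `w`: it is skipped if these coincide and traversed
    -- otherwise. The last edge `e'` is never traversed, hence `dropLast`.
    by_cases hxw : x = w
    · subst hxw
      refine ⟨y, hy, q, ?_, hc'⟩
      rw [hdl, List.map_cons]
      exact hq.cons _
    · have hexw : (e : Sym2 W) = s(x, w) := (Sym2.mem_and_mem_iff hxw).1 ⟨hx, hwe⟩
      have hadj : H.Adj x w := by
        rw [← mem_edgeSet, ← hexw]; exact e.2
      refine ⟨y, hy, .cons hadj q, ?_, ?_⟩
      · rw [hdl, List.map_cons, Walk.edges_cons, hexw]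
        exact hq.cons_cons _
      · intro c d hcd
        obtain ⟨z, hz, h⟩ := hc' c d hcd
        exact ⟨z, List.mem_cons_of_mem _ hz, h⟩

/-- A cycle in the line graph gives a closed trail in the graph through the common vertices of
consecutive edges. -/
theorem exists_closed_trail_of_lineGraph_cycle {W : Type*} {H : SimpleGraph W} {e : H.edgeSet}
    (p : H.lineGraph.Walk e e) (hp : p.IsCycle) :
    ∃ (x : W) (q : H.Walk x x), q.IsTrail ∧
      ∀ c d : H.edgeSet, s(c, d) ∈ p.edges →
        ∃ z ∈ q.support, z ∈ (c : Sym2 W) ∧ z ∈ (d : Sym2 W) := by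
  cases p with
  | nil => exact absurd rfl hp.ne_nil
  | @cons _ g _ h p =>
    obtain ⟨w, hwe, hwg⟩ := (lineGraph_adj_iff_exists.1 h).2
    obtain ⟨y, hy, q, hq, hc⟩ := exists_walk_of_lineGraph_walk p w hwg
    have hnd : (p.support.map Subtype.val).Nodup := by
      have := hp.support_nodup
      rw [Walk.support_cons, List.tail_cons] at this
      exact this.map Subtype.val_injective
    have hsplit : p.support.map Subtype.val =
        p.support.dropLast.map Subtype.val ++ [(e : Sym2 W)] := by
      have hlast : p.support = p.support.dropLast ++ [e] := by
        conv_lhs => rw [← List.dropLast_append_getLast p.support_ne_nil, Walk.getLast_support]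
      exact (congrArg (List.map Subtype.val) hlast).trans List.map_append
    rw [hsplit] at hnd
    have hc' : ∀ c d : H.edgeSet, s(c, d) ∈ (Walk.cons h p).edges →
        ∃ z ∈ q.support, z ∈ (c : Sym2 W) ∧ z ∈ (d : Sym2 W) := by
      intro c d hcd
      rw [Walk.edges_cons, List.mem_cons] at hcd
      rcases hcd with hcd | hcd
      · rcases Sym2.eq_iff.1 hcd with ⟨rfl, rfl⟩ | ⟨rfl, rfl⟩
        · exact ⟨w, q.start_mem_support, hwe, hwg⟩
        · exact ⟨w, q.start_mem_support, hwg, hwe⟩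
      · exact hc c d hcd
    -- The trail has come back to an end of `e`. Either it is already closed, or `e` itself, not yet
    -- used, closes it.
    by_cases hyw : y = w
    · subst hyw
      exact ⟨y, q, ⟨hq.nodup hnd.of_append_left⟩, hc'⟩
    · have heyw : (e : Sym2 W) = s(y, w) := (Sym2.mem_and_mem_iff hyw).1 ⟨hy, hwe⟩
      have hadj : H.Adj y w := by
        rw [← mem_edgeSet, ← heyw]; exact e.2
      refine ⟨w, q.concat hadj, ⟨?_⟩, ?_⟩
      · rw [Walk.edges_concat, List.concat_eq_append, ← heyw]
        exact (hq.append (List.Sublist.refl [(e : Sym2 W)])).nodup hnd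
      · intro c d hcd
        obtain ⟨z, hz, h⟩ := hc' c d hcd
        exact ⟨z, by rw [Walk.support_concat]; simp [hz], h⟩

/-! ### Perfect matchings of the line graph from even assignments -/

/-- The parity of the number of edges assigned to the vertex `w`. -/
def assignParity {W : Type*} [DecidableEq W] {H : SimpleGraph W} [Fintype H.edgeSet]
    (h : H.edgeSet → W) (w : W) : ZMod 2 :=
  ∑ e, if h e = w then 1 else 0

theorem sum_assignParity {W : Type*} [Fintype W] [DecidableEq W] {H : SimpleGraph W}
    [Fintype H.edgeSet] (h : H.edgeSet → W) :
    ∑ w, assignParity h w = (Fintype.card H.edgeSet : ZMod 2) := by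
  unfold assignParity
  rw [Finset.sum_comm]
  simp

theorem assignParity_eq_card {W : Type*} [DecidableEq W] {H : SimpleGraph W}
    [Fintype H.edgeSet] (h : H.edgeSet → W) (w : W) :
    assignParity h w = ((Finset.univ.filter fun e => h e = w).card : ZMod 2) := by
  simp [assignParity]

/-- Assigning one edge to its other end changes the parity at its two ends. -/
theorem exists_flip_edge {W : Type*} [DecidableEq W] {H : SimpleGraph W}
    [Fintype H.edgeSet] (h : H.edgeSet → W) (hh : ∀ e : H.edgeSet, h e ∈ (e : Sym2 W)) {a c : W}
    (hac : H.Adj a c) :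
    ∃ h' : H.edgeSet → W, (∀ e : H.edgeSet, h' e ∈ (e : Sym2 W)) ∧
      (∀ e : H.edgeSet, (e : Sym2 W) ≠ s(a, c) → h' e = h e) ∧
      ∀ w, assignParity h' w =
        assignParity h w + (if w = a then 1 else 0) + (if w = c then 1 else 0) := by
  classical
  set e₀ : H.edgeSet := ⟨s(a, c), hac⟩ with he₀
  have hne := hac.ne
  have h2 : (1 : ZMod 2) + 1 = 0 := by decide
  have h0 : h e₀ = a ∨ h e₀ = c := by simpa [he₀] using hh e₀
  refine ⟨Function.update h e₀ (if h e₀ = a then c else a), ?_, ?_, ?_⟩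
  · intro e
    by_cases he : e = e₀
    · subst he
      rw [Function.update_self]
      split_ifs <;> simp [he₀]
    · rw [Function.update_of_ne he]; exact hh e
  · intro e he
    exact Function.update_of_ne (fun h => he (by rw [h])) _ _
  · intro w
    have key : assignParity (Function.update h e₀ (if h e₀ = a then c else a)) w
        - assignParity h w = (if w = a then 1 else 0) + (if w = c then 1 else 0) := by
      unfold assignParity
      rw [← Finset.sum_sub_distrib, Fintype.sum_eq_single e₀]
      · rw [Function.update_self]
        rcases h0 with h0 | h0
        · rw [h0, if_pos rfl, sub_eq_add_neg, ZMod.neg_eq_self_mod_two, add_comm]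
          simp only [eq_comm]
        · rw [h0, if_neg hne.symm, sub_eq_add_neg, ZMod.neg_eq_self_mod_two]
          simp only [eq_comm]
      · intro e he
        rw [Function.update_of_ne he, sub_self]
    rw [add_assoc, ← key, add_sub_cancel]

/-- Reassigning the edges along a walk changes the parity at its two ends. -/
theorem exists_flip_walk {W : Type*} [DecidableEq W] {H K : SimpleGraph W}
    [Fintype H.edgeSet] (hKH : K ≤ H) {a b : W} (p : K.Walk a b)
    (h : H.edgeSet → W) (hh : ∀ e : H.edgeSet, h e ∈ (e : Sym2 W)) :
    ∃ h' : H.edgeSet → W, (∀ e : H.edgeSet, h' e ∈ (e : Sym2 W)) ∧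
      (∀ e : H.edgeSet, (e : Sym2 W) ∉ K.edgeSet → h' e = h e) ∧
      ∀ w, assignParity h' w =
        assignParity h w + (if w = a then 1 else 0) + (if w = b then 1 else 0) := by
  induction p generalizing h with
  | nil =>
    refine ⟨h, hh, fun _ _ => rfl, fun w => ?_⟩
    rw [add_assoc, CharTwo.add_self_eq_zero, add_zero]
  | @cons a c b hac p ih =>
    obtain ⟨h₁, hh₁, hk₁, hp₁⟩ := exists_flip_edge h hh (hKH hac)
    obtain ⟨h₂, hh₂, hk₂, hp₂⟩ := ih h₁ hh₁
    refine ⟨h₂, hh₂, fun e he => ?_, fun w => ?_⟩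
    · rw [hk₂ e he, hk₁ e]
      intro h
      exact he (h ▸ hac)
    · rw [hp₂, hp₁, add_assoc (assignParity h w + _), CharTwo.add_self_eq_zero, add_zero]

/-- If the vertices other than `v` are connected by edges not at `v`, an assignment that is even at
`v` can be changed into one that is even everywhere, keeping the edges at `v`. -/
theorem exists_even_assignment {W : Type*} [Fintype W] [DecidableEq W] {H K : SimpleGraph W}
    [Fintype H.edgeSet] (hKH : K ≤ H) (v : W) (hv : ∀ e ∈ K.edgeSet, v ∉ e)
    (hK : ∀ a b, a ≠ v → b ≠ v → K.Reachable a b) (heven : Even (Fintype.card H.edgeSet))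
    (h₀ : H.edgeSet → W) (hh₀ : ∀ e : H.edgeSet, h₀ e ∈ (e : Sym2 W)) (hp₀ : assignParity h₀ v = 0) :
    ∃ h : H.edgeSet → W, (∀ e : H.edgeSet, h e ∈ (e : Sym2 W)) ∧
      (∀ e : H.edgeSet, v ∈ (e : Sym2 W) → h e = h₀ e) ∧ ∀ w, assignParity h w = 0 := by
  by_cases hr : ∃ r, r ≠ v
  swap
  · push Not at hr
    exact ⟨h₀, hh₀, fun _ _ => rfl, fun w => hr w ▸ hp₀⟩
  obtain ⟨r, hr⟩ := hr
  -- The vertex `r` is a sink: each odd parity is pushed to it along a walk in `K`. Its own parity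
  -- then vanishes because all parities sum to the number of edges.
  have step : ∀ S : Finset W, ∃ h : H.edgeSet → W, (∀ e : H.edgeSet, h e ∈ (e : Sym2 W)) ∧
      (∀ e : H.edgeSet, v ∈ (e : Sym2 W) → h e = h₀ e) ∧ assignParity h v = 0 ∧
      ∀ w ∈ S, w ≠ r → assignParity h w = 0 := by
    intro S
    induction S using Finset.induction_on with
    | empty => exact ⟨h₀, hh₀, fun _ _ => rfl, hp₀, by simp⟩
    | insert a S ha ih =>
      obtain ⟨h, hh, hk, hpv, hS⟩ := ih
      by_cases hdone : a = r ∨ assignParity h a = 0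
      · refine ⟨h, hh, hk, hpv, fun w hw hwr => ?_⟩
        rcases Finset.mem_insert.1 hw with rfl | hw
        · exact hdone.resolve_left hwr
        · exact hS w hw hwr
      · push Not at hdone
        have hav : a ≠ v := by rintro rfl; exact hdone.2 hpv
        obtain ⟨p⟩ := hK a r hav hr
        obtain ⟨h', hh', hk', hp'⟩ := exists_flip_walk hKH p h hh
        refine ⟨h', hh', fun e he => ?_, ?_, fun w hw hwr => ?_⟩
        · rw [hk' e (fun hc => hv e hc he), hk e he]
        · rw [hp', hpv, if_neg hav.symm, if_neg hr.symm]; rfl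
        · rw [hp', if_neg hwr, add_zero]
          rcases Finset.mem_insert.1 hw with rfl | hw
          · rw [if_pos rfl, Fin.eq_one_of_ne_zero _ hdone.2]; rfl
          · rw [hS w hw hwr, if_neg (show w ≠ a from fun h => ha (h ▸ hw))]; rfl
  obtain ⟨h, hh, hk, -, hS⟩ := step Finset.univ
  have hall : ∀ w, w ≠ r → assignParity h w = 0 := fun w => hS w (Finset.mem_univ w)
  refine ⟨h, hh, hk, fun w => ?_⟩
  by_cases hwr : w = r
  · subst hwr
    have := sum_assignParity h
    rwa [Fintype.sum_eq_single w hall, (ZMod.natCast_eq_zero_iff_even).2 heven] at this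
  · exact hall w hwr

/-- A perfect matching of the line graph that pairs two edges at a prescribed vertex of degree
three. -/
theorem exists_perfectMatching_lineGraph {W : Type*} [Fintype W] [DecidableEq W]
    {H K : SimpleGraph W} [DecidableRel H.Adj] (hKH : K ≤ H) (v : W)
    (hv : ∀ e ∈ K.edgeSet, v ∉ e) (hK : ∀ a b, a ≠ v → b ≠ v → K.Reachable a b)
    (heven : Even (Fintype.card H.edgeSet)) (hdeg : ∀ w, H.degree w ≤ 3) (hdv : H.degree v = 3) :
    ∃ M : H.lineGraph.Subgraph, M.IsPerfectMatching ∧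
      ∃ e f : H.edgeSet, M.Adj e f ∧ ∀ z, z ∈ (e : Sym2 W) → z ∈ (f : Sym2 W) → z = v := by
  classical
  have hinc : ∀ w, (Finset.univ.filter fun e : H.edgeSet => w ∈ (e : Sym2 W)).card
      = H.degree w := by
    intro w
    rw [← card_incidenceFinset_eq_degree, ← Finset.card_map (Function.Embedding.subtype _)]
    congr 1
    ext e
    simp only [Finset.mem_map, Finset.mem_filter, Finset.mem_univ, true_and,
      Function.Embedding.subtype_apply, mem_incidenceFinset]
    exact ⟨by rintro ⟨x, hx, rfl⟩; exact ⟨x.2, hx⟩, fun h => ⟨⟨e, h.1⟩, h.2, rfl⟩⟩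
  obtain ⟨u, hvu⟩ := (H.degree_pos_iff_exists_adj v).1 (by omega)
  set e₃ : H.edgeSet := ⟨s(v, u), hvu⟩ with he₃
  -- Of the three edges at `v`, only `e₃` is sent to its other end, leaving two at `v`; the
  -- remaining choices are arbitrary.
  let h₀ : H.edgeSet → W := fun e =>
    if v ∈ (e : Sym2 W) then (if e = e₃ then u else v) else (e : Sym2 W).out.1
  have hh₀ : ∀ e : H.edgeSet, h₀ e ∈ (e : Sym2 W) := by
    intro e
    by_cases hve : v ∈ (e : Sym2 W)
    · by_cases he : e = e₃
      · simp [h₀, he, he₃]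
      · simp [h₀, he, hve]
    · simpa [h₀, hve] using Sym2.out_fst_mem _
  have hS₀ : (Finset.univ.filter fun e : H.edgeSet => h₀ e = v) =
      (Finset.univ.filter fun e : H.edgeSet => v ∈ (e : Sym2 W)).erase e₃ := by
    ext e
    simp only [Finset.mem_filter, Finset.mem_univ, true_and, Finset.mem_erase]
    constructor
    · intro h
      refine ⟨?_, h ▸ hh₀ e⟩
      rintro rfl
      have : h₀ e₃ = u := by simp [h₀, he₃]
      exact hvu.ne (h.symm.trans this)
    · rintro ⟨h1, h2⟩
      simp [h₀, h1, h2]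
  have hcard₀ : (Finset.univ.filter fun e : H.edgeSet => h₀ e = v).card = 2 := by
    rw [hS₀, Finset.card_erase_of_mem (by simp [he₃]), hinc, hdv]
  obtain ⟨h, hh, hk, hp⟩ := exists_even_assignment hKH v hv hK heven h₀ hh₀
    (by rw [assignParity_eq_card, hcard₀]; rfl)
  -- The count is even, positive and at most the degree 3.
  have hcard : ∀ e, (Finset.univ.filter fun f : H.edgeSet => h f = h e).card = 2 := by
    intro e
    have h1 : Even (Finset.univ.filter fun f : H.edgeSet => h f = h e).card := by
      rw [← ZMod.natCast_eq_zero_iff_even, ← assignParity_eq_card, hp]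
    have h2 : (Finset.univ.filter fun f : H.edgeSet => h f = h e).card ≤ 3 := by
      refine le_trans (Finset.card_le_card ?_) ((hinc (h e)).trans_le (hdeg _))
      intro f hf
      rw [Finset.mem_filter] at hf ⊢
      exact ⟨hf.1, hf.2 ▸ hh f⟩
    have h3 : 0 < (Finset.univ.filter fun f : H.edgeSet => h f = h e).card :=
      Finset.card_pos.2 ⟨e, by simp⟩
    obtain ⟨k, hk⟩ := h1
    omega
  let M : H.lineGraph.Subgraph :=
    { verts := Set.univ
      Adj := fun e f => e ≠ f ∧ h e = h f
      adj_sub := fun {e f} hef => lineGraph_adj_iff_exists.2 ⟨hef.1, h e, hh e, hef.2 ▸ hh f⟩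
      edge_vert := fun _ => Set.mem_univ _
      symm := ⟨fun _ _ hef => ⟨hef.1.symm, hef.2.symm⟩⟩ }
  refine ⟨M, ?_, ?_⟩
  · rw [Subgraph.isPerfectMatching_iff]
    intro e
    obtain ⟨f, hf⟩ := Finset.card_eq_one.1 (show
      ((Finset.univ.filter fun f : H.edgeSet => h f = h e).erase e).card = 1 by
        rw [Finset.card_erase_of_mem (by simp), hcard])
    have hmem : ∀ g, M.Adj e g ↔ g = f := by
      intro g
      rw [← Finset.mem_singleton, ← hf]
      simp only [Finset.mem_erase, Finset.mem_filter, Finset.mem_univ, true_and]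
      exact ⟨fun h => ⟨h.1.symm, h.2.symm⟩, fun h => ⟨h.1.symm, h.2.symm⟩⟩
    exact ⟨f, (hmem f).2 rfl, fun g hg => (hmem g).1 hg⟩
  · obtain ⟨e, f, hef, hset⟩ := Finset.card_eq_two.1 hcard₀
    have he : h₀ e = v := by
      have : e ∈ Finset.univ.filter fun e : H.edgeSet => h₀ e = v := by simp [hset]
      exact (Finset.mem_filter.1 this).2
    have hf : h₀ f = v := by
      have : f ∈ Finset.univ.filter fun e : H.edgeSet => h₀ e = v := by simp [hset]
      exact (Finset.mem_filter.1 this).2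
    have hve : v ∈ (e : Sym2 W) := he ▸ hh₀ e
    have hvf : v ∈ (f : Sym2 W) := hf ▸ hh₀ f
    refine ⟨e, f, ⟨hef, by rw [hk e hve, hk f hvf, he, hf]⟩, fun z hze hzf => ?_⟩
    by_contra hzv
    exact hef (Subtype.ext (((Sym2.mem_and_mem_iff hzv).1 ⟨hze, hve⟩).trans
      ((Sym2.mem_and_mem_iff hzv).1 ⟨hzf, hvf⟩).symm))

/-! ### The contraction of the Y-extension -/

/-- The contraction of the expanded graph onto the original one. -/
def yProj {V : Type*} (G : SimpleGraph V) (S : Set V) : YVertex G S → V :=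
  Sum.elim (fun w => w.1) (fun d => d.1.fst)

theorem yProj_eq_or_adj {V : Type*} {G : SimpleGraph V} {S : Set V} (x y : YVertex G S)
    (h : (yExtension G S).Adj x y) : yProj G S x = yProj G S y ∨
      G.Adj (yProj G S x) (yProj G S y) := by
  rcases x with u | d <;> rcases y with w | e
  · exact Or.inr h
  · have h : e.1.snd = u.1 := h
    right
    change G.Adj u.1 e.1.fst
    exact h ▸ e.1.adj.symm
  · have h : d.1.snd = w.1 := h
    right
    change G.Adj d.1.fst w.1
    exact h ▸ d.1.adj
  · rcases h with h | h
    · exact Or.inl h.2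
    · right
      change G.Adj d.1.fst e.1.fst
      rw [h]
      exact d.1.adj

/-- A new vertex has a single edge leaving its triangle, the survivor of the edge of its own dart.
-/
theorem snd_eq_yProj_of_adj {V : Type*} {G : SimpleGraph V} {S : Set V}
    {d : {d : G.Dart // d.fst ∈ S}} {y : YVertex G S} (h : (yExtension G S).Adj (.inr d) y)
    (hne : d.1.fst ≠ yProj G S y) : d.1.snd = yProj G S y := by
  rcases y with w | e
  · exact h
  · rcases h with h | h
    · exact absurd h.2 hne
    · change d.1.snd = e.1.fst
      rw [h]; rfl

/-- A surviving edge is determined by its image under the contraction. -/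
theorem eq_of_yProj_eq {V : Type*} {G : SimpleGraph V} {S : Set V} {x y x' y' : YVertex G S}
    (h : (yExtension G S).Adj x y) (h' : (yExtension G S).Adj x' y')
    (hne : yProj G S x ≠ yProj G S y) (hx : yProj G S x = yProj G S x')
    (hy : yProj G S y = yProj G S y') : x = x' := by
  rcases x with u | d <;> rcases x' with u' | d'
  · exact congrArg Sum.inl (Subtype.ext hx)
  · have hx : u.1 = d'.1.fst := hx
    exact absurd (hx ▸ d'.2) u.2
  · have hx : d.1.fst = u'.1 := hx
    exact absurd (hx ▸ d.2) u'.2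
  · have h1 := snd_eq_yProj_of_adj h hne
    have h2 := snd_eq_yProj_of_adj h' (by rw [← hy]; exact fun hc => hne (hx.trans hc))
    have h3 : d.1.snd = d'.1.snd := by rw [h1, h2, hy]
    exact congrArg Sum.inr (Subtype.ext (Dart.ext _ _ (Prod.ext hx h3)))

theorem yProj_injOn_edges {V : Type*} {G : SimpleGraph V} {S : Set V} :
    ∀ e ∈ (yExtension G S).edgeSet, ∀ e' ∈ (yExtension G S).edgeSet,
      ¬ (Sym2.map (yProj G S) e).IsDiag →
      Sym2.map (yProj G S) e = Sym2.map (yProj G S) e' → e = e' := by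
  intro e he e' he' hd hee
  induction e with | _ x y =>
  induction e' with | _ x' y' =>
  rw [mem_edgeSet] at he he'
  have hne : yProj G S x ≠ yProj G S y := hd
  rcases Sym2.eq_iff.1 hee with ⟨h1, h2⟩ | ⟨h1, h2⟩
  · rw [eq_of_yProj_eq he he' hne h1 h2, eq_of_yProj_eq he.symm he'.symm hne.symm h2 h1]
  · rw [eq_of_yProj_eq he he'.symm hne h1 h2, eq_of_yProj_eq he.symm he' hne.symm h2 h1,
      Sym2.eq_swap]

/-! ### Degrees and counting in the Y-extension -/

/-- The vertex of the expanded graph at the far end of the edge of a dart. -/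
noncomputable def yFar {V : Type*} (G : SimpleGraph V) (S : Set V) (d : G.Dart) : YVertex G S :=
  open Classical in
  if h : d.snd ∈ S then .inr ⟨d.symm, h⟩ else .inl ⟨d.snd, h⟩

theorem yProj_yFar {V : Type*} (G : SimpleGraph V) (S : Set V) (d : G.Dart) :
    yProj G S (yFar G S d) = d.snd := by
  unfold yFar
  split_ifs <;> rfl

theorem yExtension_neighborSet_inl {V : Type*} (G : SimpleGraph V) (S : Set V)
    (u : {w : V // w ∉ S}) :
    (yExtension G S).neighborSet (.inl u) = yFar G S '' {d | d.fst = u.1} := by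
  ext y
  constructor
  · rcases y with w | e
    · intro h
      have h : G.Adj u.1 w.1 := h
      refine ⟨⟨(u.1, w.1), h⟩, rfl, ?_⟩
      simp [yFar, w.2]
    · intro h
      have h : e.1.snd = u.1 := h
      refine ⟨e.1.symm, h, ?_⟩
      have := e.2
      simp [yFar, this]
  · rintro ⟨d, hd, rfl⟩
    have hd : d.fst = u.1 := hd
    unfold yFar
    split_ifs with h
    · exact hd
    · change G.Adj u.1 d.snd
      exact hd ▸ d.adj

theorem yExtension_neighborSet_inr {V : Type*} (G : SimpleGraph V) (S : Set V)
    (d : {d : G.Dart // d.fst ∈ S}) :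
    (yExtension G S).neighborSet (.inr d) =
      insert (yFar G S d.1) (Sum.inr '' {e | e.1.fst = d.1.fst ∧ e ≠ d}) := by
  ext y
  rw [Set.mem_insert_iff]
  constructor
  · rcases y with w | e
    · intro h
      have h : d.1.snd = w.1 := h
      left
      have h' : d.1.snd ∉ S := h ▸ w.2
      simp only [yFar, h', dite_false]
      exact congrArg Sum.inl (Subtype.ext h.symm)
    · rintro (h | h)
      · exact Or.inr ⟨e, ⟨h.2.symm, h.1.symm⟩, rfl⟩
      · left
        have h' : d.1.snd ∈ S := by
          have := e.2
          rw [h] at this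
          exact this
        simp only [yFar, h', dite_true]
        exact congrArg Sum.inr (Subtype.ext h)
  · rintro (rfl | ⟨e, he, rfl⟩)
    · unfold yFar
      split_ifs with h
      · exact Or.inr rfl
      · exact (rfl : d.1.snd = d.1.snd)
    · exact Or.inl ⟨he.2.symm, he.1.symm⟩

theorem ncard_darts_at {V : Type*} [Fintype V] [DecidableEq V] (G : SimpleGraph V)
    [DecidableRel G.Adj] (u : V) : {d : G.Dart | d.fst = u}.ncard = G.degree u := by
  rw [← G.dart_fst_fiber_card_eq_degree u, Set.ncard_eq_toFinset_card']
  simp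

theorem ncard_sub_darts_at {V : Type*} {G : SimpleGraph V} {S : Set V} (P : G.Dart → Prop)
    (hP : ∀ d, P d → d.fst ∈ S) :
    {e : {d : G.Dart // d.fst ∈ S} | P e.1}.ncard = {d : G.Dart | P d}.ncard := by
  rw [← Set.ncard_image_of_injective _ Subtype.val_injective]
  congr 1
  ext d
  exact ⟨by rintro ⟨e, he, rfl⟩; exact he, fun h => ⟨⟨d, hP d h⟩, h, rfl⟩⟩

theorem yExtension_ncard_neighborSet {V : Type*} [Fintype V] [DecidableEq V] (G : SimpleGraph V)
    [DecidableRel G.Adj] (hcubic : G.IsRegularOfDegree 3) (S : Set V) (x : YVertex G S) :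
    ((yExtension G S).neighborSet x).ncard = 3 := by
  rcases x with u | d
  · rw [yExtension_neighborSet_inl, Set.InjOn.ncard_image, ncard_darts_at, hcubic.degree_eq]
    intro d hd e he h
    have h2 := congrArg (yProj G S) h
    rw [yProj_yFar, yProj_yFar] at h2
    exact Dart.ext _ _ (Prod.ext (Eq.trans hd (Eq.symm he)) h2)
  · have hfin : Finite G.Dart := inferInstance
    rw [yExtension_neighborSet_inr, Set.ncard_insert_of_notMem,
      Set.ncard_image_of_injective _ Sum.inr_injective]
    · have h1 : {e : {d : G.Dart // d.fst ∈ S} | e.1.fst = d.1.fst ∧ e ≠ d}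
          = {e | e.1.fst = d.1.fst} \ {d} := rfl
      rw [h1, Set.ncard_sdiff_singleton_of_mem (by simp),
        ncard_sub_darts_at (fun e => e.fst = d.1.fst) (fun e he => he ▸ d.2), ncard_darts_at,
        hcubic.degree_eq]
    · rintro ⟨e, he, h⟩
      have h2 := congrArg (yProj G S) h
      rw [yProj_yFar] at h2
      have h2 : e.1.fst = d.1.snd := h2
      exact d.1.adj.ne (he.1.symm.trans h2)

theorem card_notMem_compl_singleton {V : Type*} (v : V) :
    Nat.card {w : V // w ∉ ({v}ᶜ : Set V)} = 1 := by
  rw [Nat.card_eq_one_iff_unique]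
  exact ⟨⟨fun a b => Subtype.ext ((not_not.1 a.2).trans (not_not.1 b.2).symm)⟩,
    ⟨⟨v, not_not.2 rfl⟩⟩⟩

/-- Of the 2|E(G)| darts, all but the three leaving `v` become vertices, and `v` itself is kept. -/
theorem card_yVertex_compl_singleton {V : Type*} [Fintype V] [DecidableEq V] (G : SimpleGraph V)
    [DecidableRel G.Adj] (hcubic : G.IsRegularOfDegree 3) (v : V) :
    Nat.card (YVertex G {v}ᶜ) + 2 = 2 * G.edgeFinset.card := by
  have h2 : Nat.card {d : G.Dart // d.fst ∈ ({v}ᶜ : Set V)} + 3 = 2 * G.edgeFinset.card := by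
    have h := Set.ncard_add_ncard_compl {d : G.Dart | d.fst = v}
    rw [ncard_darts_at, hcubic.degree_eq, Nat.card_eq_fintype_card,
      dart_card_eq_twice_card_edges] at h
    rw [add_comm]
    exact h
  rw [Nat.card_sum, card_notMem_compl_singleton]
  omega

theorem even_card_edgeSet_yExtension {V : Type*} [Fintype V] [DecidableEq V] (G : SimpleGraph V)
    [DecidableRel G.Adj] (hcubic : G.IsRegularOfDegree 3) (hodd : Odd G.edgeFinset.card) (v : V)
    [Fintype (YVertex G {v}ᶜ)] [DecidableRel (yExtension G {v}ᶜ).Adj]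
    (hdeg : ∀ x, (yExtension G {v}ᶜ).degree x = 3) :
    Even (Fintype.card (yExtension G {v}ᶜ).edgeSet) := by
  have h1 := (yExtension G {v}ᶜ).sum_degrees_eq_twice_card_edges
  have h2 := card_yVertex_compl_singleton G hcubic v
  simp only [hdeg, Finset.sum_const, Finset.card_univ, smul_eq_mul] at h1
  rw [Nat.card_eq_fintype_card] at h2
  rw [edgeFinset_card] at h1
  obtain ⟨k, hk⟩ := hodd
  -- With |E(G)| = 2k + 1, the expanded graph has 4k vertices, hence 6k edges.
  exact ⟨3 * k, by omega⟩

/-! ### Lifting a hamiltonian cycle of the vertex-deleted graph -/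

/-- The lift to the expanded graph of a union `C` of cycles: at each vertex, the two expanding
vertices on `C` are joined through the third one. -/
def cycleLift {V : Type*} (G : SimpleGraph V) (S : Set V) (C : SimpleGraph V) :
    SimpleGraph (YVertex G S) where
  Adj x y := ∃ d e : {d : G.Dart // d.fst ∈ S}, x = .inr d ∧ y = .inr e ∧
    ((d.1.fst = e.1.fst ∧ d ≠ e ∧ ¬ (C.Adj d.1.fst d.1.snd ∧ C.Adj e.1.fst e.1.snd)) ∨
      (e.1 = d.1.symm ∧ C.Adj d.1.fst d.1.snd))
  symm := ⟨by
    rintro _ _ ⟨d, e, rfl, rfl, h⟩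
    refine ⟨e, d, rfl, rfl, ?_⟩
    rcases h with ⟨h1, h2, h3⟩ | ⟨h1, h2⟩
    · exact Or.inl ⟨h1.symm, h2.symm, fun h => h3 h.symm⟩
    · exact Or.inr ⟨by rw [h1, Dart.symm_symm], by rw [h1]; exact h2.symm⟩⟩
  loopless := ⟨by
    rintro _ ⟨d, e, rfl, h, h'⟩
    obtain rfl := Sum.inr_injective h
    rcases h' with ⟨-, h2, -⟩ | ⟨h1, -⟩
    · exact h2 rfl
    · exact d.1.symm_ne h1.symm⟩

theorem cycleLift_adj_inr {V : Type*} {G : SimpleGraph V} {S : Set V} {C : SimpleGraph V}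
    {d e : {d : G.Dart // d.fst ∈ S}} :
    (cycleLift G S C).Adj (.inr d) (.inr e) ↔
      ((d.1.fst = e.1.fst ∧ d ≠ e ∧ ¬ (C.Adj d.1.fst d.1.snd ∧ C.Adj e.1.fst e.1.snd)) ∨
      (e.1 = d.1.symm ∧ C.Adj d.1.fst d.1.snd)) := by
  constructor
  · rintro ⟨d', e', hd, he, h⟩
    obtain rfl := Sum.inr_injective hd
    obtain rfl := Sum.inr_injective he
    exact h
  · exact fun h => ⟨d, e, rfl, rfl, h⟩

theorem not_cycleLift_adj_inl {V : Type*} {G : SimpleGraph V} {S : Set V} {C : SimpleGraph V}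
    {x : YVertex G S} {w : {w : V // w ∉ S}} : ¬ (cycleLift G S C).Adj x (.inl w) := by
  rintro ⟨_, _, _, h, _⟩
  exact Sum.inl_ne_inr h

theorem cycleLift_le {V : Type*} (G : SimpleGraph V) (S : Set V) (C : SimpleGraph V) :
    cycleLift G S C ≤ yExtension G S := by
  rintro _ _ ⟨d, e, rfl, rfl, h⟩
  rcases h with h | h
  · exact Or.inl ⟨h.2.1, h.1⟩
  · exact Or.inr h.1

theorem ncard_cycle_darts_at {V : Type*} {G C : SimpleGraph V} (hCG : C ≤ G) (u : V) :
    {d : G.Dart | d.fst = u ∧ C.Adj d.fst d.snd}.ncard = (C.neighborSet u).ncard := by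
  rw [← Set.InjOn.ncard_image (f := fun d : G.Dart => d.snd)
    (s := {d : G.Dart | d.fst = u ∧ C.Adj d.fst d.snd})]
  · congr 1
    ext w
    constructor
    · rintro ⟨d, ⟨hd, h⟩, rfl⟩
      exact hd ▸ h
    · exact fun h => ⟨⟨(u, w), hCG h⟩, ⟨rfl, h⟩, rfl⟩
  · intro d hd e he h
    exact Dart.ext _ _ (Prod.ext (hd.1.trans he.1.symm) h)

theorem ncard_noncycle_darts_at {V : Type*} [Fintype V] [DecidableEq V] {G C : SimpleGraph V}
    [DecidableRel G.Adj] (hcubic : G.IsRegularOfDegree 3) (hCG : C ≤ G) {u : V}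
    (hC : (C.neighborSet u).ncard = 2) :
    {d : G.Dart | d.fst = u ∧ ¬ C.Adj d.fst d.snd}.ncard = 1 := by
  have hfin : Finite G.Dart := inferInstance
  have h1 : {d : G.Dart | d.fst = u ∧ ¬ C.Adj d.fst d.snd} =
      {d : G.Dart | d.fst = u} \ {d : G.Dart | d.fst = u ∧ C.Adj d.fst d.snd} := by
    ext d
    exact ⟨fun h => ⟨h.1, fun h' => h.2 h'.2⟩, fun h => ⟨h.1, fun h' => h.2 ⟨h.1, h'⟩⟩⟩
  rw [h1, Set.ncard_sdiff (fun d hd => hd.1), ncard_darts_at, ncard_cycle_darts_at hCG, hC,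
    hcubic.degree_eq]

/-- A dart on `C` is joined to its reverse and to the unique dart off `C` in its triangle; a dart
off `C` is joined to the other two vertices of its triangle. -/
theorem ncard_cycleLift_neighborSet_inr {V : Type*} [Fintype V] [DecidableEq V] {G C : SimpleGraph V}
    [DecidableRel G.Adj] (hcubic : G.IsRegularOfDegree 3) (hCG : C ≤ G) {S : Set V}
    (hC : ∀ u ∈ S, (C.neighborSet u).ncard = 2) (hCS : ∀ u w, C.Adj u w → w ∈ S)
    (d : {d : G.Dart // d.fst ∈ S}) :
    ((cycleLift G S C).neighborSet (.inr d)).ncard = 2 := by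
  have hfin : Finite G.Dart := inferInstance
  by_cases hd : C.Adj d.1.fst d.1.snd
  · have h1 : (cycleLift G S C).neighborSet (.inr d) =
        insert (.inr ⟨d.1.symm, hCS _ _ hd⟩)
          (Sum.inr '' {e | e.1.fst = d.1.fst ∧ ¬ C.Adj e.1.fst e.1.snd}) := by
      ext y
      rw [Set.mem_insert_iff, mem_neighborSet]
      rcases y with w | e
      · exact ⟨fun h => absurd h not_cycleLift_adj_inl, by rintro (h | ⟨_, _, h⟩) <;> cases h⟩
      · rw [cycleLift_adj_inr, Sum.inr_injective.mem_set_image, Sum.inr_injective.eq_iff,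
          Subtype.ext_iff]
        constructor
        · rintro (⟨h1, -, h3⟩ | ⟨h1, -⟩)
          · exact Or.inr ⟨h1.symm, fun h => h3 ⟨hd, h⟩⟩
          · exact Or.inl h1
        · rintro (h | ⟨h1, h2⟩)
          · exact Or.inr ⟨h, hd⟩
          · exact Or.inl ⟨h1.symm, by rintro rfl; exact h2 hd, fun h => h2 h.2⟩
    rw [h1, Set.ncard_insert_of_notMem, Set.ncard_image_of_injective _ Sum.inr_injective,
      ncard_sub_darts_at (fun e => e.fst = d.1.fst ∧ ¬ C.Adj e.fst e.snd)
        (fun e he => he.1 ▸ d.2), ncard_noncycle_darts_at hcubic hCG (hC _ d.2)]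
    rw [Sum.inr_injective.mem_set_image]
    exact fun h => d.1.adj.ne h.1.symm
  · have h1 : (cycleLift G S C).neighborSet (.inr d) =
        Sum.inr '' ({e | e.1.fst = d.1.fst} \ {d}) := by
      ext y
      rw [mem_neighborSet]
      rcases y with w | e
      · exact ⟨fun h => absurd h not_cycleLift_adj_inl, by rintro ⟨_, _, h⟩; cases h⟩
      · rw [cycleLift_adj_inr, Sum.inr_injective.mem_set_image]
        constructor
        · rintro (⟨h1, h2, -⟩ | ⟨-, h⟩)
          · exact ⟨h1.symm, h2.symm⟩
          · exact absurd h hd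
        · rintro ⟨h1, h2⟩
          exact Or.inl ⟨h1.symm, Ne.symm h2, fun h => hd h.1⟩
    rw [h1, Set.ncard_image_of_injective _ Sum.inr_injective,
      Set.ncard_sdiff_singleton_of_mem (by simp),
      ncard_sub_darts_at (fun e => e.fst = d.1.fst) (fun e he => he ▸ d.2), ncard_darts_at,
      hcubic.degree_eq]

/-- Each triangle is connected, if necessary through its dart off `C`, and a walk in `C` links
consecutive triangles. -/
theorem cycleLift_reachable {V : Type*} [Fintype V] [DecidableEq V] {G C : SimpleGraph V}
    [DecidableRel G.Adj] (hcubic : G.IsRegularOfDegree 3) (hCG : C ≤ G) {S : Set V}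
    (hC : ∀ u ∈ S, (C.neighborSet u).ncard = 2) (hCS : ∀ u w, C.Adj u w → w ∈ S)
    (hconn : ∀ a ∈ S, ∀ b ∈ S, C.Reachable a b) (d e : {d : G.Dart // d.fst ∈ S}) :
    (cycleLift G S C).Reachable (.inr d) (.inr e) := by
  have hlocal : ∀ d e : {d : G.Dart // d.fst ∈ S}, d.1.fst = e.1.fst →
      (cycleLift G S C).Reachable (.inr d) (.inr e) := by
    intro d e hde
    by_cases heq : d = e
    · rw [heq]
    by_cases hb : C.Adj d.1.fst d.1.snd ∧ C.Adj e.1.fst e.1.snd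
    · obtain ⟨g, hg⟩ := Set.ncard_eq_one.1 (ncard_noncycle_darts_at hcubic hCG (hC _ d.2))
      have hg : g.fst = d.1.fst ∧ ¬ C.Adj g.fst g.snd := by
        have : g ∈ ({g} : Set G.Dart) := rfl
        rwa [← hg] at this
      let g' : {d : G.Dart // d.fst ∈ S} := ⟨g, hg.1 ▸ d.2⟩
      have h1 : (cycleLift G S C).Adj (.inr d) (.inr g') := cycleLift_adj_inr.2 <| Or.inl
        ⟨hg.1.symm, fun h => hg.2 (by rw [h] at hb; exact hb.1), fun h => hg.2 h.2⟩
      have h2 : (cycleLift G S C).Adj (.inr g') (.inr e) := cycleLift_adj_inr.2 <| Or.inl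
        ⟨hg.1.trans hde, fun h => hg.2 (by rw [← h] at hb; exact hb.2), fun h => hg.2 h.1⟩
      exact h1.reachable.trans h2.reachable
    · exact (cycleLift_adj_inr.2 (Or.inl ⟨hde, heq, hb⟩)).reachable
  have hwalk : ∀ {a b : V} (_ : C.Walk a b) (d e : {d : G.Dart // d.fst ∈ S}),
      d.1.fst = a → e.1.fst = b → (cycleLift G S C).Reachable (.inr d) (.inr e) := by
    intro a b p
    induction p with
    | nil => exact fun d e hd he => hlocal d e (hd.trans he.symm)
    | @cons a c b hac p ih =>
      intro d e hd he
      let g : {d : G.Dart // d.fst ∈ S} := ⟨⟨(a, c), hCG hac⟩, hCS _ _ hac.symm⟩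
      let g' : {d : G.Dart // d.fst ∈ S} := ⟨⟨(c, a), hCG hac.symm⟩, hCS _ _ hac⟩
      have h1 : (cycleLift G S C).Adj (.inr g) (.inr g') :=
        cycleLift_adj_inr.2 (Or.inr ⟨rfl, hac⟩)
      exact (hlocal d g hd).trans (h1.reachable.trans (ih g' e rfl he))
  obtain ⟨p⟩ := hconn _ d.2 _ e.2
  exact hwalk p d e rfl rfl

/-- A hamiltonian cycle of a vertex-deleted subgraph, as a spanning subgraph of the graph. -/
theorem exists_spanning_cycle_compl {V : Type*} [DecidableEq V] (G : SimpleGraph V) (v : V)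
    {a : ({v}ᶜ : Set V)} (p : (G.induce ({v}ᶜ : Set V)).Walk a a) (hp : p.IsHamiltonianCycle) :
    ∃ C : SimpleGraph V, C ≤ G ∧ (∀ u ∈ ({v}ᶜ : Set V), (C.neighborSet u).ncard = 2) ∧
      (∀ u w, C.Adj u w → w ∈ ({v}ᶜ : Set V)) ∧
      ∀ a ∈ ({v}ᶜ : Set V), ∀ b ∈ ({v}ᶜ : Set V), C.Reachable a b := by
  set q := p.map (Embedding.induce ({v}ᶜ : Set V) : G.induce ({v}ᶜ : Set V) ↪g G).toHom with hq
  have hqc : q.IsCycle := hp.isCycle.map (Embedding.induce (G := G) _).injective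
  have hsupp : ∀ u, u ∈ q.support ↔ u ∈ ({v}ᶜ : Set V) := by
    intro u
    rw [hq, Walk.support_map, List.mem_map]
    exact ⟨by rintro ⟨x, _, rfl⟩; exact x.2, fun h => ⟨⟨u, h⟩, hp.mem_support _, rfl⟩⟩
  refine ⟨q.toSubgraph.spanningCoe, q.toSubgraph.spanningCoe_le, fun u hu => ?_,
    fun u w h => ?_, fun a ha b hb => ?_⟩
  · exact hqc.ncard_neighborSet_toSubgraph_eq_two ((hsupp u).2 hu)
  · exact (hsupp w).1 (q.mem_verts_toSubgraph.1 (q.toSubgraph.edge_vert h.symm))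
  · exact reachable_spanningCoe_toSubgraph q ((hsupp a).2 ha) ((hsupp b).2 hb)

theorem exists_cycle_cycleLift {V : Type*} [Fintype V] [DecidableEq V] {G C : SimpleGraph V}
    [DecidableRel G.Adj] (hcubic : G.IsRegularOfDegree 3) (hCG : C ≤ G) {S : Set V}
    (hC : ∀ u ∈ S, (C.neighborSet u).ncard = 2) (hCS : ∀ u w, C.Adj u w → w ∈ S)
    (hconn : ∀ a ∈ S, ∀ b ∈ S, C.Reachable a b) (hS : S.Nonempty) :
    ∃ (x : YVertex G S) (p : (yExtension G S).Walk x x), p.IsCycle ∧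
      p.length = Nat.card {d : G.Dart // d.fst ∈ S} := by
  classical
  obtain ⟨u, hu⟩ := hS
  obtain ⟨w, huw⟩ := (G.degree_pos_iff_exists_adj u).1 (by rw [hcubic.degree_eq]; norm_num)
  let d₀ : {d : G.Dart // d.fst ∈ S} := ⟨⟨(u, w), huw⟩, hu⟩
  have hcyc : (cycleLift G S C).IsCycles := by
    intro x hx
    rcases x with w | d
    · obtain ⟨y, hy⟩ := hx
      exact absurd hy.symm not_cycleLift_adj_inl
    · exact ncard_cycleLift_neighborSet_inr hcubic hCG hC hCS d
  have hne : ((cycleLift G S C).neighborSet (.inr d₀)).Nonempty := by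
    apply Set.nonempty_of_ncard_ne_zero
    rw [ncard_cycleLift_neighborSet_inr hcubic hCG hC hCS d₀]
    norm_num
  obtain ⟨p, hp, hverts⟩ := hcyc.exists_cycle_toSubgraph_verts_eq_connectedComponentSupp
    (c := (cycleLift G S C).connectedComponentMk (.inr d₀)) (v := .inr d₀) rfl hne
  refine ⟨_, p.mapLe (cycleLift_le G S C), hp.mapLe _, ?_⟩
  -- The tail of the support lists each vertex of the cycle once, so its length is that of the
  -- cycle. By connectedness it consists of all the new vertices.
  have hsupp : (p.support.tail.toFinset : Set (YVertex G S)) = Set.range Sum.inr := by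
    ext x
    rw [List.coe_toFinset]
    constructor
    · intro hx
      rcases x with w | d
      · have hx : Sum.inl w ∈ p.toSubgraph.verts :=
          p.mem_verts_toSubgraph.2 (List.mem_of_mem_tail hx)
        rw [hverts] at hx
        obtain ⟨q⟩ := ConnectedComponent.exact hx
        cases q with
        | cons h _ => exact absurd h.symm not_cycleLift_adj_inl
      · exact ⟨d, rfl⟩
    · rintro ⟨d, rfl⟩
      have hx : Sum.inr d ∈ p.support := by
        rw [← p.mem_verts_toSubgraph, hverts]
        exact ConnectedComponent.sound (cycleLift_reachable hcubic hCG hC hCS hconn d d₀)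
      rw [← Walk.cons_tail_support] at hx
      rcases List.mem_cons.1 hx with h | h
      · rw [h]; exact Walk.end_mem_tail_support hp.not_nil
      · exact h
  have hlen : p.support.tail.length = p.length := by simp
  have hlen' : (p.mapLe (cycleLift_le G S C)).length = p.length := by simp
  rw [hlen', ← hlen, ← List.toFinset_card_of_nodup hp.support_nodup, ← Set.ncard_coe_finset, hsupp,
    ← Set.image_univ, Set.ncard_image_of_injective _ Sum.inr_injective, Set.ncard_univ]

/-! ### The obstruction and the two conclusions -/

theorem not_isHamiltonian_closed_trail {V : Type*} [Fintype V] [DecidableEq V]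
    (G : SimpleGraph V) [DecidableRel G.Adj] (hcubic : G.IsRegularOfDegree 3)
    (hG : ¬ G.IsHamiltonian) {S : Set V} {x : YVertex G S} (p : (yExtension G S).Walk x x)
    (hp : p.IsTrail) : ∃ u, ∀ z ∈ p.support, yProj G S z ≠ u := by
  by_contra! h
  obtain ⟨w, huw⟩ := (G.degree_pos_iff_exists_adj (yProj G S x)).1
    (by rw [hcubic.degree_eq]; norm_num)
  have : Nontrivial V := ⟨_, _, huw.ne⟩
  exact hG (isHamiltonian_of_contract_closed_trail G (fun u => (hcubic.degree_eq u).le)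
    yProj_eq_or_adj yProj_injOn_edges p hp h)

theorem circumference_yExtension {V : Type*} [Fintype V] [DecidableEq V]
    (G : SimpleGraph V) [DecidableRel G.Adj] (hcubic : G.IsRegularOfDegree 3)
    (hhypo : IsHypohamiltonian G) (v : V) :
    circumference (yExtension G {v}ᶜ) = Nat.card (YVertex G {v}ᶜ) - 1 := by
  classical
  have : Fintype (YVertex G {v}ᶜ) := Fintype.ofFinite _
  refine IsGreatest.csSup_eq ⟨?_, ?_⟩
  · obtain ⟨a, p, hp⟩ := hhypo.2 v
    obtain ⟨C, hCG, hC, hCS, hconn⟩ := exists_spanning_cycle_compl G v p hp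
    obtain ⟨x, q, hq, hlen⟩ := exists_cycle_cycleLift hcubic hCG hC hCS hconn ⟨a, a.2⟩
    refine ⟨x, q, hq, hlen.trans ?_⟩
    rw [Nat.card_sum, card_notMem_compl_singleton, Nat.add_sub_cancel_left]
  · rintro k ⟨x, p, hp, rfl⟩
    rw [Nat.card_eq_fintype_card]
    have hle : p.length ≤ Fintype.card (YVertex G {v}ᶜ) := by
      simpa using hp.support_nodup.length_le_card
    have hne : p.length ≠ Fintype.card (YVertex G {v}ᶜ) := by
      intro h
      have hham := Walk.isHamiltonianCycle_iff_isCycle_and_length_eq.2 ⟨hp, h⟩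
      obtain ⟨u, hu⟩ := not_isHamiltonian_closed_trail G hcubic hhypo.1 p hp.isTrail
      obtain ⟨w, huw⟩ := (G.degree_pos_iff_exists_adj u).1 (by rw [hcubic.degree_eq]; norm_num)
      by_cases huS : u ∈ ({v}ᶜ : Set V)
      · exact hu (.inr ⟨⟨(u, w), huw⟩, huS⟩) (hham.mem_support _) rfl
      · exact hu (.inl ⟨u, huS⟩) (hham.mem_support _) rfl
    omega

theorem not_isPMH_lineGraph_yExtension {V : Type*} [Fintype V] [DecidableEq V]
    (G : SimpleGraph V) [DecidableRel G.Adj] (hcubic : G.IsRegularOfDegree 3)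
    (hhypo : IsHypohamiltonian G) (hodd : Odd G.edgeFinset.card) (v : V)
    [DecidableEq (yExtension G {v}ᶜ).edgeSet] :
    ¬ IsPMH (yExtension G {v}ᶜ).lineGraph := by
  intro hPMH
  classical
  have : Fintype (YVertex G {v}ᶜ) := Fintype.ofFinite _
  have hdeg : ∀ x, (yExtension G {v}ᶜ).degree x = 3 := by
    intro x
    rw [← yExtension_ncard_neighborSet G hcubic {v}ᶜ x, Set.ncard_eq_toFinset_card']
    rfl
  obtain ⟨a, c, hc⟩ := hhypo.2 v
  obtain ⟨C, hCG, hC, hCS, hconn⟩ := exists_spanning_cycle_compl G v c hc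
  let v' : YVertex G {v}ᶜ := .inl ⟨v, not_not.2 rfl⟩
  have hinr : ∀ x : YVertex G {v}ᶜ, x ≠ v' → ∃ d, x = .inr d := by
    rintro (w | d) h
    · exact absurd (congrArg Sum.inl (Subtype.ext
        (show w.1 = v from not_not.1 w.2))) h
    · exact ⟨d, rfl⟩
  -- The lifted cycle serves as `K`: it avoids `v'` and connects all other vertices, so parities can
  -- be corrected without disturbing the pair at `v'`.
  obtain ⟨M, hM, e, f, hef, hv'⟩ := exists_perfectMatching_lineGraph
    (cycleLift_le G {v}ᶜ C) v'
    (by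
      intro e he hve
      induction e with | _ x y =>
      rw [mem_edgeSet] at he
      rcases Sym2.mem_iff.1 hve with rfl | rfl
      · exact not_cycleLift_adj_inl he.symm
      · exact not_cycleLift_adj_inl he)
    (by
      intro x y hx hy
      obtain ⟨d, rfl⟩ := hinr x hx
      obtain ⟨e, rfl⟩ := hinr y hy
      exact cycleLift_reachable hcubic hCG hC hCS hconn d e)
    (even_card_edgeSet_yExtension G hcubic hodd v hdeg) (fun x => (hdeg x).le) (hdeg v')
  obtain ⟨b, p, hp, hMp⟩ := hPMH M hM
  obtain ⟨x, q, hq, hcommon⟩ := exists_closed_trail_of_lineGraph_cycle p hp.isCycle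
  obtain ⟨u, hu⟩ := not_isHamiltonian_closed_trail G hcubic hhypo.1 q hq
  by_cases huv : u = v
  · obtain ⟨z, hz, hze, hzf⟩ := hcommon e f (hMp _ hef)
    exact hu z hz (by rw [hv' z hze hzf, huv]; rfl)
  -- Any edge `y y'` of the triangle at `u` has a partner in the matching, and the vertex they share
  -- is `y` or `y'`; the trail thus meets the fibre of `u`.
  · have h2 : 1 < {d : G.Dart | d.fst = u}.ncard := by
      rw [ncard_darts_at, hcubic.degree_eq]; norm_num
    obtain ⟨d, hd, d', hd', hne⟩ := (Set.one_lt_ncard (Set.toFinite _)).1 h2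
    let y : YVertex G {v}ᶜ := .inr ⟨d, fun h => huv (Eq.trans (Eq.symm hd) h)⟩
    let y' : YVertex G {v}ᶜ := .inr ⟨d', fun h => huv (Eq.trans (Eq.symm hd') h)⟩
    have hadj : (yExtension G {v}ᶜ).Adj y y' :=
      Or.inl ⟨fun h => hne (congrArg Subtype.val h), Eq.trans hd (Eq.symm hd')⟩
    obtain ⟨g, hg, -⟩ := Subgraph.isPerfectMatching_iff.1 hM ⟨s(y, y'), hadj⟩
    obtain ⟨z, hz, hzy, -⟩ := hcommon _ _ (hMp _ hg)
    rcases Sym2.mem_iff.1 hzy with rfl | rfl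
    · exact hu _ hz hd
    · exact hu _ hz hd'

end PMHLine

theorem mainTheorem8 {V : Type*} [Fintype V] [DecidableEq V]
    (G : SimpleGraph V) [DecidableRel G.Adj]
    (hcubic : G.IsRegularOfDegree 3)
    (hhypo : PMHLine.IsHypohamiltonian G)
    (hodd : Odd G.edgeFinset.card)
    (v : V) :
    PMHLine.circumference (PMHLine.yExtension G {v}ᶜ) =
        Nat.card (PMHLine.YVertex G {v}ᶜ) - 1 ∧
      ¬ PMHLine.IsPMH (PMHLine.yExtension G {v}ᶜ).lineGraph :=
  ⟨PMHLine.circumference_yExtension G hcubic hhypo v,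
    PMHLine.not_isPMH_lineGraph_yExtension G hcubic hhypo hodd v⟩
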